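/- **Theorem 2.2.** For $f\in L^2(\mathbb R)$ (complex-valued, Lebesgue measure) and $c\in\mathbb R$ put $E_cf(x)=e^{2\pi i c x}f(x)$ and $T_cf(x)=f(x-c)$. A family $(f_i)_{i\in I}$ in a Hilbert space $H$ is a *frame* for $H$ if there are constants $A,B>0$ with $A\|f\|^2\le\sum_{i}|\langle f,f_i\rangle|^2\le B\|f\|^2$ for all $f\in H$, and a *normalized tight frame* if this holds with $A=B=1$; the *frame operator* of a frame is $Sf=\sum_i\langle f,f_i\rangle f_i$. Let $g\in L^2(\mathbb R)$ and let $a,b>0$ be real numbers. The following are equivalent: 1. $(E_{mb}T_{na}g)_{m,n\in\mathbb Z}$ is a normalized tight frame for $L^2(\mathbb R)$. 2. (a) $\sum_{n\in\mathbb Z}|g(x-na)|^2=b$ for almost every $x\in\mathbb R$, and (b) for every integer $k\neq0$, $\sum_{n\in\mathbb Z}g(x-na)\overline{g(x-na-k/b)}=0$ for almost every $x\in\mathbb R$, the series converging absolutely. 3. $\langle g,E_{n/a}T_{m/b}g\rangle=0$ for all $(n,m)\in\mathbb Z^2\setminus\{(0,0)\}$, and $\|g\|^2=ab$. 4. $(E_{n/a}T_{m/b}g)_{n,m\in\mathbb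 Z}$ is an orthogonal family in $L^2(\mathbb R)$, i.e. any two members with different indices are orthogonal, and $\|g\|^2=ab$. 5. $(E_{mb}T_{na}g)_{m,n\in\mathbb Z}$ is a frame for $L^2(\mathbb R)$ and its frame operator $S$ satisfies $Sg=g$. Moreover, if these conditions hold, then $(E_{mb}T_{na}g)_{m,n\in\mathbb Z}$ is an orthonormal basis for $L^2(\mathbb R)$ if and only if $\|g\|=1$. -/

import Mathlib

open MeasureTheory
open scoped ComplexConjugate

noncomputable section

namespace WeylHeisenberg

/-- The Hilbert space of square integrable complex functions on the real line (Lebesgue measure). -/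
abbrev L2R : Type := Lp ℂ 2 (volume : Measure ℝ)

/-- Multiplication by the unimodular character `x ↦ exp (2 π i b x)` preserves `L²`. -/
theorem memLp_modulation (b : ℝ) (f : L2R) :
    MemLp (fun x : ℝ => Complex.exp (2 * Real.pi * Complex.I * b * x) * f x) 2 volume := by
  refine (Lp.memLp f).congr_norm ?_ (Filter.Eventually.of_forall fun x => ?_)
  · exact (Continuous.aestronglyMeasurable (by fun_prop)).mul (Lp.aestronglyMeasurable f)
  · have h : ‖Complex.exp (2 * Real.pi * Complex.I * b * x)‖ = 1 := by
      have e : (2 * Real.pi * Complex.I * b * x : ℂ)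
          = ((2 * Real.pi * b * x : ℝ) : ℂ) * Complex.I := by
        push_cast; ring
      rw [e, Complex.norm_exp_ofReal_mul_I]
    rw [norm_mul, h, one_mul]

/-- The modulation operator `E_b f (x) = exp (2 π i b x) f x` on `L²(ℝ)`. -/
def modulation (b : ℝ) (f : L2R) : L2R := (memLp_modulation b f).toLp _

/-- The translation operator `T_a f (x) = f (x - a)` on `L²(ℝ)`. -/
def translation (a : ℝ) (f : L2R) : L2R :=
  Lp.compMeasurePreserving (fun x : ℝ => x - a) (measurePreserving_sub_right volume a) f

theorem coeFn_modulation (b : ℝ) (f : L2R) :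
    ⇑(modulation b f) =ᵐ[volume]
      fun x : ℝ => Complex.exp (2 * Real.pi * Complex.I * b * x) * f x :=
  MemLp.coeFn_toLp _

theorem coeFn_translation (a : ℝ) (f : L2R) :
    ⇑(translation a f) =ᵐ[volume] fun x : ℝ => f (x - a) :=
  Lp.coeFn_compMeasurePreserving f (measurePreserving_sub_right volume a)

/-- The system `(E_{mβ} T_{nα} g)`, indexed by the pairs `(m, n)` of integers. -/
def system (g : L2R) (α β : ℝ) (p : ℤ × ℤ) : L2R :=
  modulation (p.1 * β) (translation (p.2 * α) g)

section Frames

variable {H : Type*} [NormedAddCommGroup H] [InnerProductSpace ℂ H] {ι : Type*}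

/-- The inequalities `A ‖f‖² ≤ ∑ |⟨f, v i⟩|² ≤ B ‖f‖²` for all `f`; the finiteness of the sum,
implicit in the upper inequality, is spelled out. -/
def HasFrameBounds (v : ι → H) (A B : ℝ) : Prop :=
  ∀ f : H, Summable (fun i => ‖inner ℂ (v i) f‖ ^ 2) ∧
    A * ‖f‖ ^ 2 ≤ ∑' i, ‖inner ℂ (v i) f‖ ^ 2 ∧
    ∑' i, ‖inner ℂ (v i) f‖ ^ 2 ≤ B * ‖f‖ ^ 2

def IsFrame (v : ι → H) : Prop :=
  ∃ A B : ℝ, 0 < A ∧ 0 < B ∧ HasFrameBounds v A B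

def IsNormalizedTightFrame (v : ι → H) : Prop :=
  HasFrameBounds v 1 1

/-- The frame operator `S f = ∑ ⟨f, v i⟩ v i`. Mathlib's `inner` is linear in its second
argument. If `v` is a frame, the series converges for every `f`: see `IsFrame.hasSum`. -/
def frameOperator (v : ι → H) (f : H) : H :=
  ∑' i, inner ℂ (v i) f • v i

theorem IsFrame.hasSum [CompleteSpace H] {v : ι → H} (hv : IsFrame v) (f : H) :
    HasSum (fun i => inner ℂ (v i) f • v i) (frameOperator v f) := by
  obtain ⟨A, B, -, hB, h⟩ := hv
  -- the square of the norm of a partial sum is at most `B` times the sum of the squared coefficients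
  have key : ∀ s : Finset ι, ‖∑ i ∈ s, inner ℂ (v i) f • v i‖ ^ 2
      ≤ B * ∑ i ∈ s, ‖inner ℂ (v i) f‖ ^ 2 := by
    intro s
    set y := ∑ i ∈ s, inner ℂ (v i) f • v i with hy
    have h1 : ‖y‖ ^ 2 ≤ ∑ i ∈ s, ‖inner ℂ (v i) f‖ * ‖inner ℂ (v i) y‖ := by
      have e : inner ℂ y y = ∑ i ∈ s, conj (inner ℂ (v i) f) * inner ℂ (v i) y := by
        conv_lhs => rw [hy, sum_inner]
        exact Finset.sum_congr rfl fun i _ => by rw [inner_smul_left]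
      have e2 : ‖y‖ ^ 2 = ‖inner ℂ y y‖ := by
        rw [inner_self_eq_norm_sq_to_K]; simp
      rw [e2, e]
      refine (norm_sum_le _ _).trans (le_of_eq (Finset.sum_congr rfl fun i _ => ?_))
      rw [norm_mul, RCLike.norm_conj]
    have h2 := Finset.sum_mul_sq_le_sq_mul_sq s
      (fun i => ‖inner ℂ (v i) f‖) (fun i => ‖inner ℂ (v i) y‖)
    have h3 : ∑ i ∈ s, ‖inner ℂ (v i) y‖ ^ 2 ≤ B * ‖y‖ ^ 2 :=
      ((h y).1.sum_le_tsum s fun i _ => by positivity).trans (h y).2.2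
    have h4 : 0 ≤ ∑ i ∈ s, ‖inner ℂ (v i) f‖ ^ 2 := by positivity
    have h5 : (‖y‖ ^ 2) ^ 2 ≤ (∑ i ∈ s, ‖inner ℂ (v i) f‖ ^ 2) * (B * ‖y‖ ^ 2) :=
      (pow_le_pow_left₀ (by positivity) h1 2).trans
        (h2.trans (mul_le_mul_of_nonneg_left h3 h4))
    rcases (sq_nonneg ‖y‖).eq_or_lt with h0 | h0
    · rw [← h0]; positivity
    · nlinarith
  refine Summable.hasSum (summable_iff_vanishing_norm.2 fun ε hε => ?_)
  obtain ⟨s, hs⟩ := summable_iff_vanishing_norm.1 (h f).1 (ε ^ 2 / B) (by positivity)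
  refine ⟨s, fun t ht => ?_⟩
  have h6 := (le_abs_self _).trans_lt (hs t ht)
  rw [lt_div_iff₀ hB] at h6
  exact lt_of_pow_lt_pow_left₀ 2 hε.le (by linarith [key t])

end Frames

end WeylHeisenberg

end

/-!
Everything reduces to one pointwise condition: for every integer `k`, the autocorrelation
`x ↦ ∑ₙ g (x - n a) * conj (g (x - n a - k / b))` is almost everywhere equal to `b` if `k = 0` and
to `0` otherwise.

*The condition and orthogonality.* The inner products of `g` with `E_{n/a} T_{k/b} g`, for `k`
fixed, are up to conjugation and a factor `a` the Fourier coefficients of the `a`-periodic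
function above. By uniqueness of Fourier coefficients in `L¹` they vanish for `n ≠ 0` exactly when
this function is constant, and the coefficient at `n = 0` gives the constant
(`integral_fourier_eq_zero_iff_ae_hasSum`, `inner_dual_eq_zero_iff_ae_hasSum`). Orthogonality of
the whole dual family follows because time-frequency shifts compose up to unimodular factors.

*The condition and tightness.* For fixed `n`, the coefficients `⟨f, E_{mb} T_{na} g⟩` are the
Fourier coefficients of the `1/b`-periodization of `f * conj (T_{na} g)`. Parseval's identity, valid
in `[0, ∞]` for integrable functions, turns the energy of all coefficients into the integral over
`x ∈ (0, 1/b]` of `∑ₙ |∑ₖ f (x - k/b) * conj (g (x - k/b - n a))|²`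
(`tsum_enorm_inner_system_sq`). The autocorrelation condition says that the sequences
`n ↦ conj (g (x - k/b - n a))` are orthogonal of norm `√b` in `ℓ²(ℤ)`, so that the integrand is `b`
times the energy of `k ↦ f (x - k/b)`. Conversely, functions `f` with prescribed finite fibres over
an arbitrary measurable set of `x` localize the tight frame identity to almost every `x`, and
polarization gives the orthogonality relations.

*The frame operator.* It commutes with the time-frequency shifts. Hence, if it fixes `g`, it fixes
every member of the system, and being symmetric it is the identity by the lower frame bound.
Conversely, the frame operator of a normalized tight frame is the identity. Finally, a normalized
tight frame is an orthonormal basis exactly when its members have norm one, and all members of the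
system have the norm of `g`.
-/

namespace WeylHeisenberg

/-! ### Frames in a Hilbert space -/

section AbstractFrames

theorem enorm_sq_eq_ofReal {E : Type*} [NormedAddCommGroup E] (z : E) :
    ‖z‖ₑ ^ 2 = ENNReal.ofReal (‖z‖ ^ 2) := by
  rw [← ofReal_norm, ENNReal.ofReal_pow (norm_nonneg _)]

variable {H : Type*} [NormedAddCommGroup H] [InnerProductSpace ℂ H] {ι : Type*}

theorem isNormalizedTightFrame_iff_enorm (v : ι → H) :
    IsNormalizedTightFrame v ↔ ∀ f : H, ∑' i, ‖inner ℂ (v i) f‖ₑ ^ 2 = ‖f‖ₑ ^ 2 := by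
  refine forall_congr' fun f => ?_
  simp only [enorm_sq_eq_ofReal, one_mul]
  constructor
  · rintro ⟨hs, h1, h2⟩
    rw [← ENNReal.ofReal_tsum_of_nonneg (fun _ => by positivity) hs, le_antisymm h2 h1]
  · intro h
    have hs : Summable fun i => ‖inner ℂ (v i) f‖ ^ 2 := by
      have := ENNReal.summable_toReal (h.trans_ne ENNReal.ofReal_ne_top)
      simpa [ENNReal.toReal_ofReal, sq_nonneg] using this
    rw [← ENNReal.ofReal_tsum_of_nonneg (fun _ => by positivity) hs,
      ENNReal.ofReal_eq_ofReal_iff (tsum_nonneg fun _ => by positivity) (by positivity)] at h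
    exact ⟨hs, h.ge, h.le⟩

theorem IsNormalizedTightFrame.isFrame {v : ι → H} (hv : IsNormalizedTightFrame v) : IsFrame v :=
  ⟨1, 1, one_pos, one_pos, hv⟩

theorem IsNormalizedTightFrame.tsum_eq {v : ι → H} (hv : IsNormalizedTightFrame v) (f : H) :
    ∑' i, ‖inner ℂ (v i) f‖ ^ 2 = ‖f‖ ^ 2 :=
  le_antisymm (by simpa using (hv f).2.2) (by simpa using (hv f).2.1)

/-- In a normalized tight frame, `‖v i‖² = ‖v i‖⁴ + ∑_{j ≠ i} |⟨v j, v i⟩|²`, so unit vectors are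
orthogonal to all the others. -/
theorem IsNormalizedTightFrame.orthonormal {v : ι → H} (hv : IsNormalizedTightFrame v)
    (h1 : ∀ i, ‖v i‖ = 1) : Orthonormal ℂ v := by
  classical
  refine ⟨h1, fun j i hij => ?_⟩
  have h2 := (hv (v i)).1.sum_le_tsum {i, j} fun _ _ => by positivity
  rw [hv.tsum_eq, Finset.sum_pair hij.symm, inner_self_eq_norm_sq_to_K, h1] at h2
  have h3 : ‖inner ℂ (v j) (v i)‖ ^ 2 ≤ 0 := by simpa using h2
  exact norm_eq_zero.1 (pow_eq_zero_iff two_ne_zero |>.1 (le_antisymm h3 (sq_nonneg _)))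

variable [CompleteSpace H]

theorem IsFrame.hasSum_inner {v : ι → H} (hv : IsFrame v) (f h : H) :
    HasSum (fun i => inner ℂ (v i) f * inner ℂ h (v i)) (inner ℂ h (frameOperator v f)) := by
  simpa only [innerSL_apply_apply, inner_smul_right] using (hv.hasSum f).mapL (innerSL ℂ h)

theorem IsFrame.inner_frameOperator_comm {v : ι → H} (hv : IsFrame v) (f h : H) :
    inner ℂ (frameOperator v h) f = inner ℂ h (frameOperator v f) := by
  have h1 := (hv.hasSum_inner h f).map (starRingEnd ℂ) Complex.continuous_conj
  rw [inner_conj_symm] at h1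
  refine h1.unique ?_
  convert hv.hasSum_inner f h using 2 with i
  simp [inner_conj_symm, mul_comm]

theorem IsFrame.inner_self_frameOperator {v : ι → H} (hv : IsFrame v) (f : H) :
    inner ℂ f (frameOperator v f) = ((∑' i, ‖inner ℂ (v i) f‖ ^ 2 : ℝ) : ℂ) := by
  rw [← (hv.hasSum_inner f f).tsum_eq, Complex.ofReal_tsum]
  refine tsum_congr fun i => ?_
  rw [← inner_conj_symm f (v i), Complex.mul_conj, Complex.normSq_eq_norm_sq]

theorem IsFrame.frameOperator_add {v : ι → H} (hv : IsFrame v) (f h : H) :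
    frameOperator v (f + h) = frameOperator v f + frameOperator v h := by
  refine (hv.hasSum (f + h)).unique ?_
  simpa only [inner_add_right, add_smul] using (hv.hasSum f).add (hv.hasSum h)

theorem IsFrame.frameOperator_smul {v : ι → H} (hv : IsFrame v) (c : ℂ) (f : H) :
    frameOperator v (c • f) = c • frameOperator v f := by
  refine (hv.hasSum (c • f)).unique ?_
  simpa only [inner_smul_right, mul_smul] using (hv.hasSum f).const_smul c

/-- The frame operator of a normalized tight frame is the identity, since its quadratic form is
`‖f‖²` and the scalars are complex. -/
theorem IsNormalizedTightFrame.frameOperator_eq {v : ι → H} (hv : IsNormalizedTightFrame v)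
    (f : H) : frameOperator v f = f := by
  let D : H →ₗ[ℂ] H :=
    { toFun := fun f => frameOperator v f - f
      map_add' := fun f h => by rw [hv.isFrame.frameOperator_add]; abel
      map_smul' := fun c f => by rw [hv.isFrame.frameOperator_smul, RingHom.id_apply, smul_sub] }
  have hD : D = 0 := by
    rw [← inner_map_self_eq_zero]
    intro f
    change inner ℂ (frameOperator v f - f) f = 0
    rw [inner_sub_left, hv.isFrame.inner_frameOperator_comm, hv.isFrame.inner_self_frameOperator,
      hv.tsum_eq, inner_self_eq_norm_sq_to_K]
    simp
  exact sub_eq_zero.1 (LinearMap.congr_fun hD f)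

/-- By symmetry, `S f - f` is orthogonal to every vector fixed by the frame operator `S`; if these
include the frame vectors, it vanishes by the lower frame bound. -/
theorem IsFrame.isNormalizedTightFrame_of_frameOperator_apply_self {v : ι → H} (hv : IsFrame v)
    (h : ∀ i, frameOperator v (v i) = v i) : IsNormalizedTightFrame v := by
  have hS : ∀ f, frameOperator v f = f := by
    intro f
    have h0 : ∀ i, inner ℂ (v i) (frameOperator v f - f) = 0 := fun i => by
      rw [inner_sub_right, ← hv.inner_frameOperator_comm, h, sub_self]
    obtain ⟨A, B, hA, -, hAB⟩ := hv
    have h1 := (hAB (frameOperator v f - f)).2.1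
    simp only [h0, norm_zero, ne_eq, OfNat.ofNat_ne_zero, not_false_eq_true, zero_pow,
      tsum_zero] at h1
    have h2 : ‖frameOperator v f - f‖ ^ 2 = 0 :=
      le_antisymm (nonpos_of_mul_nonpos_right h1 hA) (sq_nonneg _)
    exact sub_eq_zero.1 (norm_eq_zero.1 (pow_eq_zero_iff two_ne_zero |>.1 h2))
  intro f
  have h3 := hv.inner_self_frameOperator f
  rw [hS] at h3
  have h4 : ‖f‖ ^ 2 = ∑' i, ‖inner ℂ (v i) f‖ ^ 2 :=
    (inner_self_eq_norm_sq (𝕜 := ℂ) f).symm.trans (congrArg Complex.re h3)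
  obtain ⟨A, B, -, -, hAB⟩ := hv
  exact ⟨(hAB f).1, by rw [one_mul, h4], by rw [one_mul, h4]⟩

theorem IsNormalizedTightFrame.exists_hilbertBasis_iff {v : ι → H}
    (hv : IsNormalizedTightFrame v) :
    (∃ e : HilbertBasis ι ℂ H, ⇑e = v) ↔ ∀ i, ‖v i‖ = 1 := by
  constructor
  · rintro ⟨e, rfl⟩ i
    exact e.orthonormal.1 i
  · intro h1
    refine ⟨HilbertBasis.mkOfOrthogonalEqBot (hv.orthonormal h1) ?_,
      HilbertBasis.coe_mkOfOrthogonalEqBot _ _⟩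
    rw [eq_bot_iff]
    intro f hf
    have h0 : ∀ i, inner ℂ (v i) f = 0 := fun i =>
      hf (v i) (Submodule.subset_span (Set.mem_range_self i))
    have := hv.tsum_eq f
    simp only [h0, norm_zero, ne_eq, OfNat.ofNat_ne_zero, not_false_eq_true, zero_pow,
      tsum_zero] at this
    simpa using this.symm

end AbstractFrames

/-! ### Fourier series of integrable functions -/

section FourierSeries

open AddCircle Filter Topology Set

variable {T : ℝ} [hT : Fact (0 < T)]

/-- Uniqueness of Fourier coefficients for integrable functions. By density of the trigonometric
polynomials, the function integrates to zero against continuous functions, hence over closed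
sets. -/
theorem ae_eq_zero_of_fourierCoeff_eq_zero {h : AddCircle T → ℂ} (hh : Integrable h haarAddCircle)
    (h0 : ∀ n, fourierCoeff h n = 0) : h =ᵐ[haarAddCircle] 0 := by
  have bd : ∀ φ : C(AddCircle T, ℂ), Integrable (fun t => φ t * h t) haarAddCircle := fun φ =>
    hh.bdd_mul φ.continuous.aestronglyMeasurable (Eventually.of_forall φ.norm_coe_le_norm)
  let Λ : C(AddCircle T, ℂ) →L[ℂ] ℂ := LinearMap.mkContinuous
    { toFun := fun φ => ∫ t, φ t * h t ∂haarAddCircle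
      map_add' := fun φ ψ => by
        rw [← integral_add (bd φ) (bd ψ)]; simp only [ContinuousMap.add_apply, add_mul]
      map_smul' := fun c φ => by
        simp only [ContinuousMap.smul_apply, smul_eq_mul, mul_assoc, integral_const_mul,
          RingHom.id_apply] }
    (∫ t, ‖h t‖ ∂haarAddCircle) (fun φ => by
      rw [mul_comm, ← integral_const_mul]
      refine norm_integral_le_of_norm_le (hh.norm.const_mul _) (Eventually.of_forall fun t => ?_)
      rw [norm_mul]
      exact mul_le_mul_of_nonneg_right (φ.norm_coe_le_norm t) (norm_nonneg _))
  have hΛ : ∀ φ, Λ φ = 0 := by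
    intro φ
    have hφ : φ ∈ (Submodule.span ℂ (range (@fourier T))).topologicalClosure := by
      rw [span_fourier_closure_eq_top]; trivial
    have hle : (Submodule.span ℂ (range (@fourier T))).topologicalClosure ≤
        LinearMap.ker Λ.toLinearMap := by
      refine Submodule.topologicalClosure_minimal _ (Submodule.span_le.2 ?_) Λ.isClosed_ker
      rintro _ ⟨n, rfl⟩
      have := h0 (-n)
      simp only [fourierCoeff, neg_neg, smul_eq_mul] at this
      exact this
    exact hle hφ
  refine ae_eq_zero_of_forall_setIntegral_isClosed_eq_zero hh fun F hF => ?_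
  have hlim : Tendsto (fun n => ∫ t, (((hF.apprSeq n t : NNReal) : ℝ) : ℂ) * h t ∂haarAddCircle)
      atTop (𝓝 (∫ t, F.indicator (fun t => h t) t ∂haarAddCircle)) := by
    refine tendsto_integral_of_dominated_convergence (fun t => ‖h t‖) (fun n => ?_) hh.norm
      (fun n => Eventually.of_forall fun t => ?_) (Eventually.of_forall fun t => ?_)
    · refine AEStronglyMeasurable.mul (Continuous.aestronglyMeasurable ?_) hh.1
      exact Complex.continuous_ofReal.comp
        (NNReal.continuous_coe.comp (hF.apprSeq n).continuous)
    · rw [norm_mul, Complex.norm_real, Real.norm_of_nonneg (NNReal.coe_nonneg _)]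
      exact mul_le_of_le_one_left (norm_nonneg _)
        (by exact_mod_cast HasOuterApproxClosed.apprSeq_apply_le_one hF n t)
    · have h1 := (tendsto_pi_nhds.1 (HasOuterApproxClosed.tendsto_apprSeq hF) t)
      have h2 := ((Complex.continuous_ofReal.comp NNReal.continuous_coe).tendsto _).comp h1
      have h3 := h2.mul_const (h t)
      have e : F.indicator (fun t => h t) t
          = (Complex.ofReal ∘ NNReal.toReal) (F.indicator (fun _ => 1) t) * h t := by
        by_cases ht : t ∈ F <;> simp [ht]
      rw [e]
      exact h3
  rw [← integral_indicator hF.measurableSet]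
  refine tendsto_nhds_unique hlim (tendsto_const_nhds.congr fun n => ?_)
  exact (hΛ ⟨fun t => (((hF.apprSeq n t : NNReal) : ℝ) : ℂ), Complex.continuous_ofReal.comp
        (NNReal.continuous_coe.comp (hF.apprSeq n).continuous)⟩).symm

/-- Parseval's identity in `[0, ∞]` for integrable functions: if the coefficients are square
summable, they are those of an `L²` function, which agrees with the given one by uniqueness. -/
theorem tsum_enorm_fourierCoeff_sq {h : AddCircle T → ℂ} (hh : Integrable h haarAddCircle) :
    ∑' n, ‖fourierCoeff h n‖ₑ ^ 2 = ∫⁻ t, ‖h t‖ₑ ^ 2 ∂haarAddCircle := by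
  have key : ∀ u : Lp ℂ 2 (@haarAddCircle T hT),
      ∑' n, ‖fourierCoeff u n‖ₑ ^ 2 = ∫⁻ t, ‖u t‖ₑ ^ 2 ∂haarAddCircle := by
    intro u
    have h1 := hasSum_sq_fourierCoeff u
    simp only [enorm_sq_eq_ofReal]
    rw [← ENNReal.ofReal_tsum_of_nonneg (fun _ => by positivity) h1.summable, h1.tsum_eq,
      ofReal_integral_eq_lintegral_ofReal _ (Eventually.of_forall fun _ => by positivity)]
    exact (Lp.memLp u).integrable_norm_pow two_ne_zero
  by_cases hfin : ∑' n, ‖fourierCoeff h n‖ₑ ^ 2 = ⊤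
  · by_cases h2 : MemLp h 2 haarAddCircle
    · rw [fourierCoeff_congr_ae h2.coeFn_toLp.symm, key]
      exact lintegral_congr_ae (h2.coeFn_toLp.mono fun t ht => by simp only [ht])
    · rw [hfin]
      by_contra hne
      refine h2 ⟨hh.1, ?_⟩
      rw [eLpNorm_lt_top_iff_lintegral_rpow_enorm_lt_top two_ne_zero ENNReal.ofNat_ne_top]
      simpa using lt_top_iff_ne_top.2 (Ne.symm hne)
  · have hmem : Memℓp (fourierCoeff h) 2 := by
      refine memℓp_gen ?_
      have := ENNReal.summable_toReal hfin
      simpa using this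
    let u : Lp ℂ 2 (@haarAddCircle T hT) := fourierBasis.repr.symm ⟨_, hmem⟩
    have hu : ∀ n, fourierCoeff u n = fourierCoeff h n := fun n => by
      rw [← fourierBasis_repr]; simp [u]
    have hui : Integrable u haarAddCircle := (Lp.memLp u).integrable one_le_two
    have hae : h =ᵐ[haarAddCircle] u := by
      have := ae_eq_zero_of_fourierCoeff_eq_zero (hh.sub hui) fun n => by
        have e1 : fourierCoeff (h - ⇑u) n = fourierCoeff h n - fourierCoeff u n := by
          simp only [fourierCoeff, Pi.sub_apply, smul_sub]
          exact integral_sub (hh.fourier_smul _) (hui.fourier_smul _)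
        rw [e1, hu, sub_self]
      exact this.mono fun t ht => sub_eq_zero.1 ht
    rw [fourierCoeff_congr_ae hae, key]
    exact lintegral_congr_ae (hae.mono fun t ht => by simp only [ht])

/-- Parseval's identity in `[0, ∞]` on the interval `(0, T]`. -/
theorem tsum_enorm_setIntegral_fourier_sq {F : ℝ → ℂ} (hF : IntegrableOn F (Ioc 0 T)) :
    ∑' n : ℤ, ‖∫ x in Ioc 0 T, fourier (-n) (x : AddCircle T) * F x‖ₑ ^ 2
      = ENNReal.ofReal T * ∫⁻ x in Ioc 0 T, ‖F x‖ₑ ^ 2 := by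
  have hT0 : 0 < T := hT.out
  let u : AddCircle T → ℂ := liftIoc T 0 F
  have hu1 : ∀ x ∈ Ioc (0 : ℝ) T, u x = F x := fun x hx =>
    liftIoc_coe_apply (by simpa using hx)
  have hu : Integrable u haarAddCircle := by
    rw [← memLp_one_iff_integrable, memLp_haarAddCircle_iff]
    refine MemLp.memLp_liftIoc (memLp_one_iff_integrable.2 ?_)
    simpa [IntegrableOn] using hF
  have hc : ∀ n : ℤ, ∫ x in Ioc 0 T, fourier (-n) (x : AddCircle T) * F x
      = T * fourierCoeff u n := by
    intro n
    rw [fourierCoeff_eq_intervalIntegral u n 0, zero_add, intervalIntegral.integral_of_le hT0.le,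
      Complex.real_smul]
    have e1 : ∫ x in Ioc 0 T, fourier (-n) (x : AddCircle T) • u x
        = ∫ x in Ioc 0 T, fourier (-n) (x : AddCircle T) * F x :=
      setIntegral_congr_fun measurableSet_Ioc fun x hx => by
        simp only [hu1 x hx, smul_eq_mul]
    rw [e1]
    have : (T : ℂ) ≠ 0 := by exact_mod_cast hT0.ne'
    push_cast
    field_simp
  have hl : ∫⁻ x in Ioc 0 T, ‖F x‖ₑ ^ 2
      = ENNReal.ofReal T * ∫⁻ t, ‖u t‖ₑ ^ 2 ∂haarAddCircle := by
    have e1 : ∫⁻ x in Ioc 0 T, ‖F x‖ₑ ^ 2 = ∫⁻ x in Ioc 0 T, ‖u x‖ₑ ^ 2 :=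
      setLIntegral_congr_fun measurableSet_Ioc fun x hx => by simp only [hu1 x hx]
    have e2 := AddCircle.lintegral_preimage T 0 fun t => ‖u t‖ₑ ^ 2
    rw [zero_add] at e2
    rw [e1, e2, volume_eq_smul_haarAddCircle, lintegral_smul_measure, smul_eq_mul]
  have hTe : ‖(T : ℂ)‖ₑ = ENNReal.ofReal T := by
    rw [← ofReal_norm, Complex.norm_real, Real.norm_of_nonneg hT0.le]
  simp only [hc, enorm_mul, mul_pow, ENNReal.tsum_mul_left]
  rw [tsum_enorm_fourierCoeff_sq hu, hl, hTe, pow_two, mul_assoc]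

end FourierSeries

/-! ### Periodization -/

section Periodization

open AddCircle Filter Topology Set

theorem lintegral_eq_tsum_Ioc {T : ℝ} (hT : 0 < T) (f : ℝ → ENNReal) :
    ∫⁻ x, f x = ∑' k : ℤ, ∫⁻ x in Ioc 0 T, f (x - k * T) := by
  have hd := isAddFundamentalDomain_Ioc hT 0 volume
  rw [zero_add] at hd
  rw [hd.lintegral_eq_tsum']
  let e := Equiv.ofInjective (fun n : ℤ => n • T) (zsmul_left_strictMono hT).injective
  refine (e.tsum_eq (fun g : AddSubgroup.zmultiples T => ∫⁻ x in Ioc 0 T, f (-g +ᵥ x))).symm.trans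
    (tsum_congr fun k => ?_)
  refine lintegral_congr fun x => ?_
  congr 1
  change -(k • T) + x = x - k * T
  rw [zsmul_eq_mul]; ring

theorem integral_eq_tsum_Ioc {T : ℝ} (hT : 0 < T) {f : ℝ → ℂ} (hf : Integrable f) :
    ∫ x, f x = ∑' k : ℤ, ∫ x in Ioc 0 T, f (x - k * T) := by
  have hd := isAddFundamentalDomain_Ioc hT 0 volume
  rw [zero_add] at hd
  rw [hd.integral_eq_tsum' f hf]
  let e := Equiv.ofInjective (fun n : ℤ => n • T) (zsmul_left_strictMono hT).injective
  refine (e.tsum_eq (fun g : AddSubgroup.zmultiples T => ∫ x in Ioc 0 T, f (-g +ᵥ x))).symm.trans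
    (tsum_congr fun k => ?_)
  congr 1
  funext x
  congr 1
  change -(k • T) + x = x - k * T
  rw [zsmul_eq_mul]; ring

theorem ae_sub_const {p : ℝ → Prop} (hp : ∀ᵐ x : ℝ, p x) (c : ℝ) : ∀ᵐ x : ℝ, p (x - c) :=
  (measurePreserving_sub_right volume c).quasiMeasurePreserving.ae hp

/-- A property holds almost everywhere on the line if and only if, for almost every `x` in one
period, it holds at all translates of `x` by the period. -/
theorem ae_iff_ae_restrict_Ioc {T : ℝ} (hT : 0 < T) (p : ℝ → Prop) :
    (∀ᵐ x : ℝ, p x) ↔ ∀ᵐ x ∂volume.restrict (Ioc 0 T), ∀ k : ℤ, p (x - k * T) := by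
  constructor
  · exact fun h => ae_restrict_of_ae (ae_all_iff.2 fun k => ae_sub_const h _)
  · intro h
    rw [ae_restrict_iff' measurableSet_Ioc] at h
    have h2 : ∀ᵐ x : ℝ, ∀ j : ℤ, x - j * T ∈ Ioc 0 T → ∀ k : ℤ, p (x - j * T - k * T) :=
      ae_all_iff.2 fun j => ae_sub_const h _
    filter_upwards [h2] with x hx
    have h3 := sub_toIocDiv_zsmul_mem_Ioc hT 0 x
    rw [zsmul_eq_mul, zero_add] at h3
    have h4 := hx _ h3 (-toIocDiv hT 0 x)
    have e : x - (toIocDiv hT 0 x) * T - ((-toIocDiv hT 0 x : ℤ) : ℝ) * T = x := by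
      push_cast; ring
    rwa [e] at h4

/-- The `T`-periodization `x ↦ ∑ₖ H (x - k T)` of a function on the line; by the convention for
`tsum`, it is zero at the points where the series does not converge absolutely. -/
noncomputable def periodize (T : ℝ) (H : ℝ → ℂ) (x : ℝ) : ℂ := ∑' k : ℤ, H (x - k * T)

theorem tsum_lintegral_enorm_Ioc_ne_top {T : ℝ} (hT : 0 < T) {H : ℝ → ℂ} (hi : Integrable H) :
    ∑' k : ℤ, ∫⁻ x in Ioc 0 T, ‖H (x - k * T)‖ₑ ≠ ⊤ := by
  rw [← lintegral_eq_tsum_Ioc hT fun x => ‖H x‖ₑ]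
  exact hi.2.ne

theorem ae_summable_sub_mul {T : ℝ} (hT : 0 < T) {H : ℝ → ℂ} (hm : Measurable H)
    (hi : Integrable H) :
    ∀ᵐ x ∂volume.restrict (Ioc 0 T), Summable fun k : ℤ => H (x - k * T) := by
  have h1 := tsum_lintegral_enorm_Ioc_ne_top hT hi
  rw [← lintegral_tsum fun _ => by fun_prop] at h1
  filter_upwards [ae_lt_top (by fun_prop) h1] with x hx
  exact Summable.of_norm (tsum_enorm_ne_top_iff_summable_norm.1 hx.ne)

theorem measurable_periodize (T : ℝ) {H : ℝ → ℂ} (hm : Measurable H) :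
    Measurable (periodize T H) :=
  Measurable.tsum fun _ => hm.comp (measurable_id.sub_const _)

theorem integrableOn_periodize {T : ℝ} (hT : 0 < T) {H : ℝ → ℂ} (hm : Measurable H)
    (hi : Integrable H) : IntegrableOn (periodize T H) (Ioc 0 T) := by
  refine ⟨(measurable_periodize T hm).aestronglyMeasurable, ?_⟩
  refine lt_of_le_of_lt (lintegral_mono fun x => enorm_tsum_le_tsum_enorm) ?_
  rw [lintegral_tsum fun _ => by fun_prop]
  exact (tsum_lintegral_enorm_Ioc_ne_top hT hi).lt_top

theorem setIntegral_periodize {T : ℝ} (hT : 0 < T) {H : ℝ → ℂ} (hm : Measurable H)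
    (hi : Integrable H) : ∫ x in Ioc 0 T, periodize T H x = ∫ x, H x := by
  rw [integral_eq_tsum_Ioc hT hi]
  exact integral_tsum (fun k => (hm.comp (measurable_id.sub_const _)).aestronglyMeasurable)
    (tsum_lintegral_enorm_Ioc_ne_top hT hi)

theorem measurable_fourier_coe (T : ℝ) (n : ℤ) :
    Measurable fun x : ℝ => fourier n (x : AddCircle T) :=
  ((fourier n).continuous.comp (AddCircle.continuous_mk' T)).measurable

variable {T : ℝ} [hT : Fact (0 < T)]

theorem setIntegral_fourier_mul_periodize {H : ℝ → ℂ} (hm : Measurable H) (hi : Integrable H)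
    (n : ℤ) : ∫ x in Ioc 0 T, fourier n (x : AddCircle T) * periodize T H x
      = ∫ x : ℝ, fourier n (x : AddCircle T) * H x := by
  have hm' : Measurable fun x : ℝ => fourier n (x : AddCircle T) * H x :=
    (measurable_fourier_coe T n).mul hm
  have hi' : Integrable fun x : ℝ => fourier n (x : AddCircle T) * H x :=
    hi.bdd_mul (measurable_fourier_coe T n).aestronglyMeasurable (c := 1)
      (Eventually.of_forall fun x => by rw [fourier_apply, Circle.norm_coe])
  rw [← setIntegral_periodize hT.out hm' hi']
  congr 1
  funext x
  rw [periodize, periodize, ← tsum_mul_left]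
  refine tsum_congr fun k => ?_
  have e : ((x - k * T : ℝ) : AddCircle T) = (x : AddCircle T) := by
    rw [← zsmul_eq_mul, AddCircle.coe_sub, AddCircle.coe_zsmul, AddCircle.coe_period, smul_zero,
      sub_zero]
  simp only [e]

/-- Parseval's identity for the periodization of an integrable function on the line. -/
theorem tsum_enorm_integral_fourier_sq {H : ℝ → ℂ} (hm : Measurable H) (hi : Integrable H) :
    ∑' n : ℤ, ‖∫ x : ℝ, fourier (-n) (x : AddCircle T) * H x‖ₑ ^ 2
      = ENNReal.ofReal T * ∫⁻ x in Ioc 0 T, ‖periodize T H x‖ₑ ^ 2 := by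
  rw [← tsum_enorm_setIntegral_fourier_sq (integrableOn_periodize hT.out hm hi)]
  simp only [setIntegral_fourier_mul_periodize hm hi]

theorem setIntegral_fourier_of_ne_zero {n : ℤ} (hn : n ≠ 0) :
    ∫ x in Ioc 0 T, fourier n (x : AddCircle T) = 0 := by
  have h := AddCircle.integral_preimage T 0 fun t => fourier n t
  rw [zero_add] at h
  rw [h]
  exact integral_eq_zero_of_add_right_eq_neg (fourier_add_half_inv_index hn hT.out)

/-- The periodization of `H` is the constant `K` exactly when the Fourier
transform of `H` vanishes at the nonzero frequencies `n / T` and is `T K` at zero. -/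
theorem integral_fourier_eq_zero_iff_ae_hasSum {H : ℝ → ℂ} (hm : Measurable H)
    (hi : Integrable H) (K : ℂ) :
    ((∀ n : ℤ, n ≠ 0 → ∫ x : ℝ, fourier (-n) (x : AddCircle T) * H x = 0) ∧ ∫ x, H x = T * K)
      ↔ ∀ᵐ x : ℝ, HasSum (fun k : ℤ => H (x - k * T)) K := by
  have hT0 := hT.out
  have hconst : IntegrableOn (fun _ : ℝ => K) (Ioc 0 T) := integrableOn_const (by simp)
  have hKint : ∫ _ in Ioc 0 T, K = T * K := by
    simp [Real.volume_real_Ioc_of_le hT0.le]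
  have hper := integrableOn_periodize hT0 hm hi
  constructor
  · rintro ⟨h1, h2⟩
    have hz : ∀ n : ℤ, ∫ x in Ioc 0 T, fourier (-n) (x : AddCircle T) * (periodize T H x - K)
        = 0 := by
      intro n
      have hb : ∀ {F : ℝ → ℂ}, IntegrableOn F (Ioc 0 T) →
          IntegrableOn (fun x : ℝ => fourier (-n) (x : AddCircle T) * F x) (Ioc 0 T) := fun hF =>
        hF.bdd_mul (measurable_fourier_coe T _).aestronglyMeasurable (c := 1)
          (Eventually.of_forall fun x => by rw [fourier_apply, Circle.norm_coe])
      simp only [mul_sub]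
      rw [integral_sub (hb hper) (hb hconst), setIntegral_fourier_mul_periodize hm hi,
        integral_mul_const]
      by_cases hn : n = 0
      · subst hn
        simp only [neg_zero, fourier_zero, one_mul, h2]
        rw [← integral_mul_const]
        simp only [one_mul, hKint, sub_self]
      · rw [h1 n hn, setIntegral_fourier_of_ne_zero (neg_ne_zero.2 hn), zero_mul, sub_zero]
    -- all coefficients of `periodize T H - K` vanish, so it is zero by Parseval
    have hP := tsum_enorm_setIntegral_fourier_sq (hper.sub hconst)
    simp only [Pi.sub_apply, hz] at hP
    simp only [enorm_zero, ne_eq, OfNat.ofNat_ne_zero, not_false_eq_true, zero_pow,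
      tsum_zero] at hP
    have h3 := (mul_eq_zero.1 hP.symm).resolve_left (by simpa using hT0)
    rw [lintegral_eq_zero_iff
      (((measurable_periodize T hm).sub_const K).enorm.pow_const 2)] at h3
    rw [ae_iff_ae_restrict_Ioc hT0]
    filter_upwards [h3, ae_summable_sub_mul hT0 hm hi] with x hx hs j
    have h4 : periodize T H x = K := by
      simpa [sub_eq_zero] using hx
    have h5 : HasSum (fun k : ℤ => H (x - k * T)) K := h4 ▸ hs.hasSum
    rw [← (Equiv.addLeft j).hasSum_iff] at h5
    convert h5 using 2 with k
    simp only [Function.comp, Equiv.coe_addLeft]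
    push_cast
    ring_nf
  · intro h
    have h1 : ∀ᵐ x ∂volume.restrict (Ioc 0 T), periodize T H x = K := by
      filter_upwards [ae_restrict_of_ae h] with x hx using hx.tsum_eq
    refine ⟨fun n hn => ?_, ?_⟩
    · have h2 : ∀ᵐ x : ℝ ∂volume.restrict (Ioc 0 T),
          fourier (-n) (x : AddCircle T) * periodize T H x
          = fourier (-n) (x : AddCircle T) * K := h1.mono fun x hx => by rw [hx]
      rw [← setIntegral_fourier_mul_periodize hm hi, integral_congr_ae h2, integral_mul_const,
        setIntegral_fourier_of_ne_zero (neg_ne_zero.2 hn), zero_mul]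
    · rw [← setIntegral_periodize hT0 hm hi, integral_congr_ae h1, hKint]

end Periodization

/-! ### Time-frequency shifts -/

section TimeFrequencyShifts

open AddCircle

theorem norm_modulation (b : ℝ) (f : L2R) : ‖modulation b f‖ = ‖f‖ := by
  rw [Lp.norm_def, Lp.norm_def]
  congr 1
  refine eLpNorm_congr_norm_ae ((coeFn_modulation b f).mono fun x hx => ?_)
  have e : (2 * Real.pi * Complex.I * b * x : ℂ)
      = ((2 * Real.pi * b * x : ℝ) : ℂ) * Complex.I := by
    push_cast; ring
  rw [hx, norm_mul, e, Complex.norm_exp_ofReal_mul_I, one_mul]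

/-- The modulation operator as a linear isometry. -/
noncomputable def modulationIsometry (b : ℝ) : L2R →ₗᵢ[ℂ] L2R where
  toFun := modulation b
  map_add' f h := by
    refine Lp.ext ?_
    filter_upwards [coeFn_modulation b (f + h), coeFn_modulation b f, coeFn_modulation b h,
      Lp.coeFn_add f h, Lp.coeFn_add (modulation b f) (modulation b h)] with x h1 h2 h3 h4 h5
    rw [h1, h5, h4, Pi.add_apply, Pi.add_apply, h2, h3, mul_add]
  map_smul' c f := by
    refine Lp.ext ?_
    filter_upwards [coeFn_modulation b (c • f), coeFn_modulation b f,
      Lp.coeFn_smul c f, Lp.coeFn_smul c (modulation b f)] with x h1 h2 h3 h4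
    rw [h1, RingHom.id_apply, h4, h3, Pi.smul_apply, Pi.smul_apply, h2, smul_eq_mul, smul_eq_mul,
      mul_left_comm]
  norm_map' := norm_modulation b

/-- The operator `E_{mβ} T_{nα}`, for `p = (m, n)`, as a linear isometry. -/
noncomputable def timeFreqShift (α β : ℝ) (p : ℤ × ℤ) : L2R →ₗᵢ[ℂ] L2R :=
  (modulationIsometry (p.1 * β)).comp
    (Lp.compMeasurePreservingₗᵢ ℂ (fun x : ℝ => x - p.2 * α)
      (measurePreserving_sub_right volume (p.2 * α)))

theorem timeFreqShift_apply (α β : ℝ) (p : ℤ × ℤ) (g : L2R) :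
    timeFreqShift α β p g = system g α β p :=
  rfl

theorem norm_system (g : L2R) (α β : ℝ) (p : ℤ × ℤ) : ‖system g α β p‖ = ‖g‖ := by
  rw [← timeFreqShift_apply, LinearIsometry.norm_map]

theorem coeFn_system (g : L2R) (α β : ℝ) (p : ℤ × ℤ) :
    ⇑(system g α β p) =ᵐ[volume] fun x : ℝ =>
      Complex.exp (2 * Real.pi * Complex.I * (p.1 * β : ℝ) * x) * g (x - p.2 * α) := by
  filter_upwards [coeFn_modulation (p.1 * β) (translation (p.2 * α) g),
    coeFn_translation (p.2 * α) g] with x h1 h2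
  rw [system, h1, h2]

theorem system_zero (g : L2R) (α β : ℝ) : system g α β 0 = g := by
  refine Lp.ext ?_
  filter_upwards [coeFn_system g α β 0] with x hx
  simp [hx]

/-- The time-frequency shifts compose up to unimodular factors. -/
theorem exists_system_add_eq (g : L2R) (α β : ℝ) (p q : ℤ × ℤ) :
    ∃ c : ℂ, ‖c‖ = 1 ∧ system g α β (p + q) = c • timeFreqShift α β p (system g α β q) := by
  refine ⟨Complex.exp ((2 * Real.pi * (q.1 * β) * (p.2 * α) : ℝ) * Complex.I),
    Complex.norm_exp_ofReal_mul_I _, ?_⟩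
  rw [timeFreqShift_apply]
  refine Lp.ext ?_
  filter_upwards [coeFn_system g α β (p + q), Lp.coeFn_smul (Complex.exp
    ((2 * Real.pi * (q.1 * β) * (p.2 * α) : ℝ) * Complex.I)) (system (system g α β q) α β p),
    coeFn_system (system g α β q) α β p, ae_sub_const (coeFn_system g α β q) (p.2 * α)]
    with x h1 h2 h3 h4
  have e : x - ((p + q).2 : ℤ) * α = x - p.2 * α - q.2 * α := by
    rw [Prod.snd_add]; push_cast; ring
  rw [h2, Pi.smul_apply, h3, h4, h1, smul_eq_mul, ← mul_assoc, ← mul_assoc, ← Complex.exp_add,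
    ← Complex.exp_add, e, Prod.fst_add]
  congr 2
  push_cast
  ring

theorem exists_inner_system_eq (g : L2R) (α β : ℝ) (p q : ℤ × ℤ) :
    ∃ c : ℂ, ‖c‖ = 1 ∧
      inner ℂ (system g α β p) (system g α β (p + q)) = c * inner ℂ g (system g α β q) := by
  obtain ⟨c, hc, h⟩ := exists_system_add_eq g α β p q
  exact ⟨c, hc, by rw [h, inner_smul_right, ← timeFreqShift_apply α β p g,
    LinearIsometry.inner_map_map]⟩

theorem pairwise_inner_system_eq_zero_iff (g : L2R) (α β : ℝ) :
    (Pairwise fun p q => inner ℂ (system g α β p) (system g α β q) = 0) ↔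
      ∀ p, p ≠ 0 → inner ℂ g (system g α β p) = 0 := by
  constructor
  · intro h p hp
    simpa only [system_zero] using h hp.symm
  · intro h p q hpq
    obtain ⟨c, -, hc⟩ := exists_inner_system_eq g α β p (q - p)
    rw [add_sub_cancel, h _ (sub_ne_zero.2 hpq.symm), mul_zero] at hc
    exact hc

/-- The frame operator of the system commutes with the time-frequency shifts: a shift permutes the
system up to unimodular factors, which cancel in `⟨f, v⟩ v`. -/
theorem frameOperator_system {g : L2R} {α β : ℝ} (hF : IsFrame (system g α β)) (p : ℤ × ℤ) :
    frameOperator (system g α β) (system g α β p)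
      = timeFreqShift α β p (frameOperator (system g α β) g) := by
  have h1 := hF.hasSum (system g α β p)
  rw [← (Equiv.addLeft p).hasSum_iff] at h1
  refine h1.unique ?_
  have h2 := (hF.hasSum g).mapL (timeFreqShift α β p).toContinuousLinearMap
  rw [LinearIsometry.coe_toContinuousLinearMap] at h2
  convert h2 using 2 with q
  obtain ⟨c, hc, h⟩ := exists_system_add_eq g α β p q
  simp only [Function.comp, Equiv.coe_addLeft, map_smul]
  rw [h, inner_smul_left, ← timeFreqShift_apply α β p g, LinearIsometry.inner_map_map, smul_smul,
    mul_right_comm, mul_comm (conj c), Complex.mul_conj, Complex.normSq_eq_norm_sq, hc]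
  simp

theorem isNormalizedTightFrame_system_iff (g : L2R) (α β : ℝ) :
    IsNormalizedTightFrame (system g α β) ↔
      IsFrame (system g α β) ∧ frameOperator (system g α β) g = g := by
  refine ⟨fun h => ⟨h.isFrame, h.frameOperator_eq g⟩, fun ⟨hF, hg⟩ => ?_⟩
  refine hF.isNormalizedTightFrame_of_frameOperator_apply_self fun p => ?_
  rw [frameOperator_system hF, hg, timeFreqShift_apply]

theorem measurable_coeFn (f : L2R) : Measurable f :=
  (Lp.stronglyMeasurable f).measurable

theorem measurable_mul_conj_sub (f g : L2R) (d : ℝ) :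
    Measurable fun x : ℝ => f x * conj (g (x - d)) :=
  (measurable_coeFn f).mul
    (Complex.continuous_conj.measurable.comp ((measurable_coeFn g).comp (measurable_sub_const d)))

theorem integrable_mul_conj_sub (f g : L2R) (d : ℝ) :
    Integrable fun x : ℝ => f x * conj (g (x - d)) := by
  refine (L2.integrable_inner (𝕜 := ℂ) (translation d g) f).congr ?_
  filter_upwards [coeFn_translation d g] with x hx
  rw [hx, RCLike.inner_apply]

/-- The inner products with `E_{n/T} T_d g` are the values at `n / T` of the Fourier transform of
`x ↦ f x * conj (g (x - d))`. -/
theorem inner_modulation_translation (f g : L2R) {T c d : ℝ} {n : ℤ} (hc : c = n / T) :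
    inner ℂ (modulation c (translation d g)) f
      = ∫ x : ℝ, fourier (-n) (x : AddCircle T) * (f x * conj (g (x - d))) := by
  rw [L2.inner_def]
  refine integral_congr_ae ?_
  filter_upwards [coeFn_modulation c (translation d g), coeFn_translation d g] with x h1 h2
  have e : (2 * Real.pi * Complex.I * c * x : ℂ) = 2 * Real.pi * Complex.I * n * x / T := by
    rw [hc]; push_cast; ring
  rw [h1, h2, RCLike.inner_apply, map_mul, fourier_neg, fourier_coe_apply, e]
  ring

end TimeFrequencyShifts

/-! ### Orthogonality along the dual lattice -/

section Orthogonality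

variable (g : L2R) {a b : ℝ}

theorem integral_mul_conj_self (f : L2R) : ∫ x : ℝ, f x * conj (f x) = (‖f‖ : ℂ) ^ 2 := by
  have h := inner_self_eq_norm_sq_to_K (𝕜 := ℂ) f
  rw [L2.inner_def] at h
  simp only [RCLike.inner_apply] at h
  exact h

/-- Orthogonality of `g` to its shifts along the dual lattice, in terms of the autocorrelations
of `g`. -/
theorem inner_dual_eq_zero_iff_ae_hasSum (ha : 0 < a) (b : ℝ) :
    ((∀ n m : ℤ, (n, m) ≠ (0, 0) →
        inner ℂ g (modulation (n / a) (translation (m / b) g)) = 0) ∧ ‖g‖ ^ 2 = a * b) ↔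
      ∀ k : ℤ, ∀ᵐ x : ℝ, HasSum (fun n : ℤ => g (x - n * a) * conj (g (x - n * a - k / b)))
        (if k = 0 then (b : ℂ) else 0) := by
  have : Fact (0 < a) := ⟨ha⟩
  have key : ∀ n m : ℤ, inner ℂ g (modulation (n / a) (translation (m / b) g)) = 0 ↔
      ∫ x : ℝ, fourier (-n) (x : AddCircle a) * (g x * conj (g (x - m / b))) = 0 := fun n m => by
    rw [← inner_modulation_translation g g rfl, inner_eq_zero_symm]
  have hs := fun k : ℤ => integral_fourier_eq_zero_iff_ae_hasSum (T := a)
    (measurable_mul_conj_sub g g (k / b)) (integrable_mul_conj_sub g g (k / b))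
    (if k = 0 then (b : ℂ) else 0)
  simp only [← hs, key]
  have hn : ∫ x : ℝ, g x * conj (g (x - ((0 : ℤ) : ℝ) / b)) = (‖g‖ : ℂ) ^ 2 := by
    simp only [Int.cast_zero, zero_div, sub_zero, integral_mul_conj_self]
  constructor
  · rintro ⟨h1, h2⟩ k
    refine ⟨fun n hn => h1 n k (by simp [hn]), ?_⟩
    by_cases hk : k = 0
    · subst hk
      rw [hn, if_pos rfl]
      exact_mod_cast h2
    · have := h1 0 k (by simp [hk])
      simpa only [neg_zero, fourier_zero, one_mul, if_neg hk, mul_zero] using this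
  · intro h
    refine ⟨fun n m hnm => ?_, ?_⟩
    · by_cases hn0 : n = 0
      · subst hn0
        have hm : m ≠ 0 := fun hm => hnm (by rw [hm])
        simpa only [neg_zero, fourier_zero, one_mul, if_neg hm, mul_zero] using (h m).2
      · exact (h m).1 n hn0
    · have := (h 0).2
      rw [hn, if_pos rfl] at this
      exact_mod_cast this

end Orthogonality

/-! ### Orthogonal families of sequences -/

section SequenceSpace

theorem hasSum_norm_sq_of_tsum_enorm_sq {w : ℤ → ℂ} {c : ℝ} (hc : 0 ≤ c)
    (h : ∑' n, ‖w n‖ₑ ^ 2 = ENNReal.ofReal c) : HasSum (fun n => ‖w n‖ ^ 2) c := by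
  simp only [enorm_sq_eq_ofReal] at h
  have hs : Summable fun n => ‖w n‖ ^ 2 := by
    have := ENNReal.summable_toReal (h.trans_ne ENNReal.ofReal_ne_top)
    simpa [ENNReal.toReal_ofReal, sq_nonneg] using this
  rw [← ENNReal.ofReal_tsum_of_nonneg (fun _ => by positivity) hs,
    ENNReal.ofReal_eq_ofReal_iff (tsum_nonneg fun _ => by positivity) hc] at h
  exact h ▸ hs.hasSum

theorem hasSum_norm_sq_iff {w : ℤ → ℂ} {c : ℝ} :
    HasSum (fun n => w n * conj (w n)) (c : ℂ) ↔ HasSum (fun n => ‖w n‖ ^ 2) c := by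
  simp only [Complex.mul_conj, Complex.normSq_eq_norm_sq]
  exact Complex.hasSum_ofReal

theorem lp_tsum_enorm_sq (w : lp (fun _ : ℤ => ℂ) 2) : ∑' n, ‖w n‖ₑ ^ 2 = ‖w‖ₑ ^ 2 := by
  have h := lp.hasSum_norm (p := 2) (by norm_num) w
  simp only [ENNReal.toReal_ofNat, Real.rpow_ofNat] at h
  simp only [enorm_sq_eq_ofReal]
  rw [← ENNReal.ofReal_tsum_of_nonneg (fun _ => by positivity) h.summable, h.tsum_eq]

theorem memℓp_two_of_tsum_ne_top {w : ℤ → ℂ} (h : ∑' n, ‖w n‖ₑ ^ 2 ≠ ⊤) : Memℓp w 2 :=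
  memℓp_gen (by simpa using ENNReal.summable_toReal h)

/-- Orthogonal vectors `u k` of norm `√b` in `ℓ²(ℤ)` synthesize isometrically up to the factor
`√b`. -/
theorem tsum_enorm_tsum_mul_sq {b : ℝ} (hb : 0 < b) {u : ℤ → ℤ → ℂ}
    (hu : ∀ j k, HasSum (fun n => u k n * conj (u j n)) (if j = k then (b : ℂ) else 0))
    {c : ℤ → ℂ} (hc : ∑' k, ‖c k‖ₑ ^ 2 ≠ ⊤) :
    ∑' n, ‖∑' k, c k * u k n‖ₑ ^ 2 = ENNReal.ofReal b * ∑' k, ‖c k‖ₑ ^ 2 := by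
  have hU : ∀ k, Memℓp (u k) 2 := fun k => by
    refine memℓp_gen ?_
    have h := hu k k
    rw [if_pos rfl, hasSum_norm_sq_iff] at h
    simpa using h.summable
  let U : ℤ → lp (fun _ : ℤ => ℂ) 2 := fun k => ⟨u k, hU k⟩
  have hs : (Real.sqrt b : ℂ) ≠ 0 := by
    exact_mod_cast (Real.sqrt_pos.2 hb).ne'
  have hs2 : (Real.sqrt b : ℂ) * (Real.sqrt b : ℂ) = b := by
    exact_mod_cast Real.mul_self_sqrt hb.le
  let e : ℤ → lp (fun _ : ℤ => ℂ) 2 := fun k => (Real.sqrt b : ℂ)⁻¹ • U k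
  have he : Orthonormal ℂ e := by
    rw [orthonormal_iff_ite]
    intro j k
    have h1 : inner ℂ (U j) (U k) = if j = k then (b : ℂ) else 0 := by
      refine (lp.hasSum_inner (U j) (U k)).unique ?_
      simpa only [RCLike.inner_apply] using hu j k
    simp only [e, inner_smul_left, inner_smul_right, h1, map_inv₀, Complex.conj_ofReal]
    split_ifs
    · rw [← hs2]; field_simp
    · simp
  have hd : ∑' k, ‖(Real.sqrt b : ℂ) * c k‖ₑ ^ 2 = ENNReal.ofReal b * ∑' k, ‖c k‖ₑ ^ 2 := by
    rw [← ENNReal.tsum_mul_left]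
    refine tsum_congr fun k => ?_
    rw [enorm_mul, mul_pow, enorm_sq_eq_ofReal (Real.sqrt b : ℂ), Complex.norm_real,
      Real.norm_of_nonneg (Real.sqrt_nonneg b), Real.sq_sqrt hb.le]
  let d : lp (fun _ : ℤ => ℂ) 2 := ⟨fun k => (Real.sqrt b : ℂ) * c k,
    memℓp_two_of_tsum_ne_top (by rw [hd]; exact ENNReal.mul_ne_top ENNReal.ofReal_ne_top hc)⟩
  let s := he.orthogonalFamily.linearIsometry d
  -- the synthesis `s = ∑ₖ c k • U k` converges in `ℓ²`, hence coordinatewise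
  have hsum : HasSum (fun k => c k • U k) s := by
    convert he.orthogonalFamily.hasSum_linearIsometry d using 2 with k
    simp only [LinearIsometry.toSpanSingleton_apply, e, d, smul_smul]
    congr 1
    field_simp
  have hcoord : ∀ n, ∑' k, c k * u k n = s n := fun n => by
    have h := hsum.mapL (lp.evalCLM ℂ (fun _ : ℤ => ℂ) 2 n)
    exact h.tsum_eq
  simp only [hcoord]
  rw [lp_tsum_enorm_sq, ← hd]
  have : ‖s‖ₑ = ‖d‖ₑ := by
    rw [← ofReal_norm, ← ofReal_norm, LinearIsometry.norm_map]
  rw [this, ← lp_tsum_enorm_sq]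

/-- Polarization for sequences: `u + v` gives the real part and `u + i v` the imaginary part of
the inner product. -/
theorem hasSum_mul_conj_eq_zero_of_norm_sq {u v : ℤ → ℂ} {b : ℝ}
    (hu : HasSum (fun n => ‖u n‖ ^ 2) b) (hv : HasSum (fun n => ‖v n‖ ^ 2) b)
    (h1 : HasSum (fun n => ‖u n + v n‖ ^ 2) (b + b))
    (hI : HasSum (fun n => ‖u n + Complex.I * v n‖ ^ 2) (b + b)) :
    HasSum (fun n => u n * conj (v n)) 0 := by
  have hre := ((h1.sub (hu.add hv)).mul_left (1 / 2))
  have him := ((hI.sub (hu.add hv)).mul_left (1 / 2))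
  rw [sub_self, mul_zero] at hre him
  rw [Complex.hasSum_iff]
  constructor
  · refine (congrArg (HasSum · 0) (funext fun n => ?_)).mp hre
    simp only [Complex.sq_norm, Complex.normSq_apply, Complex.add_re, Complex.add_im,
      Complex.mul_re, Complex.conj_re, Complex.conj_im]
    ring
  · refine (congrArg (HasSum · 0) (funext fun n => ?_)).mp him
    simp only [Complex.sq_norm, Complex.normSq_apply, Complex.add_re, Complex.add_im,
      Complex.mul_re, Complex.mul_im, Complex.conj_re, Complex.conj_im, Complex.I_re, Complex.I_im]
    ring

end SequenceSpace

/-! ### The fibres of the system -/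

section Fibres

variable (g : L2R) (a T : ℝ)

/-- The fibre over `x` of the translates of `g`: the sequences `k ↦ conj (g (x - k T - n a))`,
indexed by `n`; the conjugate makes the coefficients of `f` linear in `fibre`. -/
noncomputable def fibre (x : ℝ) (k n : ℤ) : ℂ := conj (g (x - k * T - n * a))

theorem measurable_fibre (k n : ℤ) : Measurable fun x => fibre g a T x k n :=
  Complex.continuous_conj.measurable.comp
    ((measurable_coeFn g).comp ((measurable_sub_const _).comp (measurable_sub_const _)))

variable {T}

theorem enorm_sq_eq_lintegral (f : L2R) (hT : 0 < T) :
    ‖f‖ₑ ^ 2 = ∫⁻ x in Set.Ioc 0 T, ∑' k : ℤ, ‖f (x - k * T)‖ₑ ^ 2 := by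
  have hm : ∀ k : ℤ, AEMeasurable (fun x : ℝ => ‖f (x - k * T)‖ₑ ^ 2)
      (volume.restrict (Set.Ioc 0 T)) := fun k =>
    (((measurable_coeFn f).comp (measurable_sub_const _)).enorm.pow_const 2).aemeasurable
  rw [lintegral_tsum hm]
  have h := lintegral_eq_tsum_Ioc hT fun x => ‖f x‖ₑ ^ 2
  rw [← h, Lp.enorm_def]
  have h2 := eLpNorm_nnreal_pow_eq_lintegral (μ := (volume : Measure ℝ)) (f := f) (p := 2)
    two_ne_zero
  simpa using h2

/-- The energy of the coefficients of `f` in the system `E_{m/T} T_{na} g`, computed fibrewise. -/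
theorem tsum_enorm_inner_system_sq (f : L2R) (hT : 0 < T) :
    ∑' p, ‖inner ℂ (system g a T⁻¹ p) f‖ₑ ^ 2
      = ENNReal.ofReal T * ∫⁻ x in Set.Ioc 0 T,
        ∑' n : ℤ, ‖∑' k : ℤ, f (x - k * T) * fibre g a T x k n‖ₑ ^ 2 := by
  have : Fact (0 < T) := ⟨hT⟩
  rw [ENNReal.tsum_prod', ENNReal.tsum_comm]
  have h : ∀ n : ℤ, ∑' m : ℤ, ‖inner ℂ (system g a T⁻¹ (m, n)) f‖ₑ ^ 2
      = ENNReal.ofReal T * ∫⁻ x in Set.Ioc 0 T,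
        ‖∑' k : ℤ, f (x - k * T) * fibre g a T x k n‖ₑ ^ 2 := fun n => by
    have h1 := tsum_enorm_integral_fourier_sq (T := T) (measurable_mul_conj_sub f g (n * a))
      (integrable_mul_conj_sub f g (n * a))
    rw [← tsum_congr fun m : ℤ => by
      rw [← inner_modulation_translation f g (div_eq_mul_inv (m : ℝ) T).symm]] at h1
    exact h1
  simp only [h]
  rw [ENNReal.tsum_mul_left, lintegral_tsum fun n => ?_]
  refine (Measurable.enorm (Measurable.tsum fun k => ?_)).pow_const 2 |>.aemeasurable
  exact ((measurable_coeFn f).comp (measurable_sub_const _)).mul (measurable_fibre g a T k n)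

/-- Orthogonality within the fibres over `(0, T]` is the vanishing of the autocorrelations on the
whole line, the pair `(j, k)` over `x` corresponding to the shift `k - j` at the point `x - j T`. -/
theorem ae_hasSum_fibre_iff (hT : 0 < T) (b : ℝ) :
    (∀ᵐ x ∂volume.restrict (Set.Ioc 0 T), ∀ j k : ℤ,
      HasSum (fun n => fibre g a T x k n * conj (fibre g a T x j n))
        (if j = k then (b : ℂ) else 0)) ↔
    ∀ k : ℤ, ∀ᵐ x : ℝ, HasSum (fun n : ℤ => g (x - n * a) * conj (g (x - n * a - k * T)))
        (if k = 0 then (b : ℂ) else 0) := by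
  simp only [ae_iff_ae_restrict_Ioc hT, ← ae_all_iff (ι := ℤ)]
  have e : ∀ x (j k n : ℤ), fibre g a T x (k + j) n * conj (fibre g a T x j n)
      = g (x - j * T - n * a) * conj (g (x - j * T - n * a - k * T)) := fun x j k n => by
    have e1 : x - ((k + j : ℤ) : ℝ) * T - n * a = x - j * T - n * a - k * T := by
      push_cast; ring
    rw [fibre, fibre, Complex.conj_conj, mul_comm, e1]
  refine Filter.eventually_congr (Filter.Eventually.of_forall fun x => ⟨fun h k j => ?_,
    fun h j k => ?_⟩)
  · simpa only [e, right_eq_add] using h j (k + j)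
  · have := h (k - j) j
    simpa only [← e, sub_add_cancel, sub_eq_zero, @eq_comm _ j k] using this

/-- If the sequences `fibre g a T x k` are orthogonal of norm `T ^ (-1/2)` for almost every `x`,
the coefficients of `f` carry on almost every fibre `T⁻¹` times the energy of the fibre of `f`. -/
theorem isNormalizedTightFrame_of_ae_hasSum_fibre (hT : 0 < T)
    (h : ∀ᵐ x ∂volume.restrict (Set.Ioc 0 T), ∀ j k : ℤ,
      HasSum (fun n => fibre g a T x k n * conj (fibre g a T x j n))
        (if j = k then ((T⁻¹ : ℝ) : ℂ) else 0)) :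
    IsNormalizedTightFrame (system g a T⁻¹) := by
  rw [isNormalizedTightFrame_iff_enorm]
  intro f
  have hf := enorm_sq_eq_lintegral f hT
  have hm : Measurable fun x => ∑' k : ℤ, ‖f (x - k * T)‖ₑ ^ 2 :=
    Measurable.tsum fun k =>
      ((measurable_coeFn f).comp (measurable_sub_const _)).enorm.pow_const 2
  have hfin := ae_lt_top hm (hf.symm.trans_ne (by finiteness))
  have hcongr : ∀ᵐ x ∂volume.restrict (Set.Ioc 0 T),
      ∑' n : ℤ, ‖∑' k : ℤ, f (x - k * T) * fibre g a T x k n‖ₑ ^ 2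
        = ENNReal.ofReal T⁻¹ * ∑' k : ℤ, ‖f (x - k * T)‖ₑ ^ 2 := by
    filter_upwards [h, hfin] with x hx hx2
    exact tsum_enorm_tsum_mul_sq (inv_pos.2 hT) hx hx2.ne
  rw [tsum_enorm_inner_system_sq g a f hT, lintegral_congr_ae hcongr, lintegral_const_mul _ hm,
    ← hf, ← mul_assoc, ← ENNReal.ofReal_mul hT.le, mul_inv_cancel₀ hT.ne', ENNReal.ofReal_one,
    one_mul]

theorem add_mul_notMem_Ioc {x : ℝ} (hT : 0 < T) (hx : x ∈ Set.Ioc 0 T) {i : ℤ} (hi : i ≠ 0) :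
    x + i * T ∉ Set.Ioc 0 T := by
  rintro ⟨h1, h2⟩
  rcases lt_or_gt_of_ne hi with h | h
  · have : (i : ℝ) ≤ -1 := by exact_mod_cast Int.le_sub_one_of_lt h
    nlinarith [hx.2]
  · have : (1 : ℝ) ≤ i := by exact_mod_cast h
    nlinarith [hx.1]

/-- A square integrable function whose fibre over `x ∈ (0, T]` is the sequence `w`, cut
off outside the finite set `s`, for `x ∈ A`, and zero otherwise. -/
theorem exists_fibre_eq (hT : 0 < T) {A : Set ℝ} (hA : MeasurableSet A) (hAT : A ⊆ Set.Ioc 0 T)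
    (s : Finset ℤ) (w : ℤ → ℂ) :
    ∃ f : L2R, ∀ᵐ x ∂volume.restrict (Set.Ioc 0 T), ∀ j : ℤ,
      f (x - j * T) = if j ∈ s then A.indicator (fun _ => w j) x else 0 := by
  let f₀ : ℝ → ℂ := fun x => ∑ k ∈ s, A.indicator (fun _ => w k) (x - (-k * T))
  have hf₀ : MemLp f₀ 2 volume := by
    refine memLp_finsetSum s fun k _ => ?_
    exact (memLp_indicator_const 2 hA (w k)
      (Or.inr ((measure_mono hAT).trans_lt (by simp)).ne)).comp_measurePreserving
        (measurePreserving_sub_right volume (-k * T))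
  refine ⟨hf₀.toLp f₀, ?_⟩
  have h := (ae_iff_ae_restrict_Ioc hT _).1 hf₀.coeFn_toLp
  rw [ae_restrict_iff' measurableSet_Ioc] at h ⊢
  filter_upwards [h] with x hx hxT j
  rw [hx hxT j]
  -- the translates of `A` by multiples of `T` are disjoint, so one summand survives
  have h0 : ∀ k ∈ s, k ≠ j → A.indicator (fun _ => w k) (x - j * T - (-k * T)) = 0 := by
    intro k _ hkj
    refine Set.indicator_of_notMem (fun hmem => ?_) _
    have := hAT hmem
    have e : x - j * T - (-k * T) = x + ((k - j : ℤ) : ℝ) * T := by push_cast; ring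
    rw [e] at this
    exact add_mul_notMem_Ioc hT hxT (sub_ne_zero.2 hkj) this
  have hj : x - j * T - (-j * T) = x := by ring
  change ∑ k ∈ s, A.indicator (fun _ => w k) (x - j * T - (-k * T)) = _
  split_ifs with hjs
  · rw [Finset.sum_eq_single_of_mem j hjs h0, hj]
  · exact Finset.sum_eq_zero fun k hk => h0 k hk (fun hkj => hjs (hkj ▸ hk))

/-- Testing a normalized tight frame on functions with prescribed finite fibres, over arbitrary
measurable subsets of `(0, T]`, localizes the energy identity to almost every fibre. -/
theorem IsNormalizedTightFrame.ae_tsum_enorm_sum_fibre (hT : 0 < T)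
    (h : IsNormalizedTightFrame (system g a T⁻¹)) (s : Finset ℤ) (w : ℤ → ℂ) :
    ∀ᵐ x ∂volume.restrict (Set.Ioc 0 T),
      ∑' n : ℤ, ‖∑ k ∈ s, w k * fibre g a T x k n‖ₑ ^ 2
        = ENNReal.ofReal (T⁻¹ * ∑ k ∈ s, ‖w k‖ ^ 2) := by
  have hm : Measurable fun x => ∑' n : ℤ, ‖∑ k ∈ s, w k * fibre g a T x k n‖ₑ ^ 2 :=
    Measurable.tsum fun n => (Measurable.enorm (Finset.measurable_sum s fun k _ =>
      (measurable_fibre g a T k n).const_mul _)).pow_const 2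
  have key : (fun x => ENNReal.ofReal T * ∑' n : ℤ, ‖∑ k ∈ s, w k * fibre g a T x k n‖ₑ ^ 2)
      =ᵐ[volume.restrict (Set.Ioc 0 T)] fun _ => ∑ k ∈ s, ‖w k‖ₑ ^ 2 := by
    refine ae_eq_of_forall_setLIntegral_eq_of_sigmaFinite (hm.const_mul _) measurable_const
      fun A' hA' _ => ?_
    rw [Measure.restrict_restrict hA']
    set A := A' ∩ Set.Ioc 0 T with hAdef
    have hA : MeasurableSet A := hA'.inter measurableSet_Ioc
    have hAT : A ⊆ Set.Ioc 0 T := Set.inter_subset_right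
    obtain ⟨f, hf⟩ := exists_fibre_eq hT hA hAT s w
    have h1 := (isNormalizedTightFrame_iff_enorm _).1 h f
    rw [tsum_enorm_inner_system_sq g a f hT, enorm_sq_eq_lintegral f hT] at h1
    have hl : ∀ᵐ x ∂volume.restrict (Set.Ioc 0 T),
        ∑' n : ℤ, ‖∑' k : ℤ, f (x - k * T) * fibre g a T x k n‖ₑ ^ 2
          = A.indicator (fun x => ∑' n : ℤ, ‖∑ k ∈ s, w k * fibre g a T x k n‖ₑ ^ 2) x := by
      filter_upwards [hf] with x hx
      have e : ∀ n : ℤ, ∑' k : ℤ, f (x - k * T) * fibre g a T x k n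
          = ∑ k ∈ s, A.indicator (fun _ => w k) x * fibre g a T x k n := fun n => by
        rw [tsum_eq_sum (s := s) fun k hk => by rw [hx, if_neg hk, zero_mul]]
        exact Finset.sum_congr rfl fun k hk => by rw [hx, if_pos hk]
      simp only [e]
      by_cases hxA : x ∈ A <;> simp [hxA]
    have hr : ∀ᵐ x ∂volume.restrict (Set.Ioc 0 T), ∑' k : ℤ, ‖f (x - k * T)‖ₑ ^ 2
        = A.indicator (fun _ => ∑ k ∈ s, ‖w k‖ₑ ^ 2) x := by
      filter_upwards [hf] with x hx
      rw [tsum_eq_sum (s := s) fun k hk => by rw [hx, if_neg hk]; simp]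
      rw [Finset.sum_congr rfl fun k hk => by rw [hx, if_pos hk]]
      by_cases hxA : x ∈ A <;> simp [hxA]
    rw [lintegral_congr_ae hl, lintegral_congr_ae hr, setLIntegral_indicator hA,
      setLIntegral_indicator hA, Set.inter_eq_left.2 hAT] at h1
    rw [lintegral_const_mul _ hm, h1]
  filter_upwards [key] with x hx
  have hx' := congrArg (fun t => ENNReal.ofReal T⁻¹ * t) hx
  rw [← mul_assoc, ← ENNReal.ofReal_mul (inv_pos.2 hT).le, inv_mul_cancel₀ hT.ne',
    ENNReal.ofReal_one, one_mul] at hx'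
  rw [hx', ENNReal.ofReal_mul (inv_pos.2 hT).le,
    ENNReal.ofReal_sum_of_nonneg fun _ _ => by positivity]
  simp only [enorm_sq_eq_ofReal]

theorem IsNormalizedTightFrame.ae_hasSum_fibre (hT : 0 < T)
    (h : IsNormalizedTightFrame (system g a T⁻¹)) :
    ∀ᵐ x ∂volume.restrict (Set.Ioc 0 T), ∀ j k : ℤ,
      HasSum (fun n => fibre g a T x k n * conj (fibre g a T x j n))
        (if j = k then ((T⁻¹ : ℝ) : ℂ) else 0) := by
  have hT' := inv_pos.2 hT
  have h1 : ∀ᵐ x ∂volume.restrict (Set.Ioc 0 T), ∀ k : ℤ, _ :=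
    ae_all_iff.2 fun k => h.ae_tsum_enorm_sum_fibre g a hT {k} (fun _ => 1)
  have h2 : ∀ ζ : ℂ, ∀ᵐ x ∂volume.restrict (Set.Ioc 0 T), ∀ j k : ℤ, _ := fun ζ =>
    ae_all_iff.2 fun j => ae_all_iff.2 fun k =>
      h.ae_tsum_enorm_sum_fibre g a hT {k, j} (fun i => if i = k then 1 else ζ)
  filter_upwards [h1, h2 1, h2 Complex.I] with x hx1 hx2 hx3 j k
  have hd : ∀ k, HasSum (fun n => ‖fibre g a T x k n‖ ^ 2) T⁻¹ := fun k =>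
    hasSum_norm_sq_of_tsum_enorm_sq hT'.le (by simpa using hx1 k)
  by_cases hjk : j = k
  · subst hjk
    rw [if_pos rfl, hasSum_norm_sq_iff]
    exact hd j
  · rw [if_neg hjk]
    refine hasSum_mul_conj_eq_zero_of_norm_sq (hd k) (hd j)
      (hasSum_norm_sq_of_tsum_enorm_sq (by positivity) ?_)
      (hasSum_norm_sq_of_tsum_enorm_sq (by positivity) ?_)
    · have := hx2 j k
      simpa [Finset.sum_pair (Ne.symm hjk), hjk, mul_add] using this
    · have := hx3 j k
      simpa [Finset.sum_pair (Ne.symm hjk), hjk, mul_add] using this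

end Fibres

/-! ### Characterization by autocorrelations -/

/-- Tightness in terms of autocorrelations: the system is a normalized tight frame exactly when the
autocorrelations of `g` along `aℤ` equal `b` at the shift `0` and zero at the shifts `k / b`,
`k ≠ 0`. -/
theorem isNormalizedTightFrame_system_iff_ae_hasSum (g : L2R) (a : ℝ) {b : ℝ} (hb : 0 < b) :
    IsNormalizedTightFrame (system g a b) ↔
      ∀ k : ℤ, ∀ᵐ x : ℝ, HasSum (fun n : ℤ => g (x - n * a) * conj (g (x - n * a - k / b)))
        (if k = 0 then (b : ℂ) else 0) := by
  have hT := inv_pos.2 hb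
  have h1 := ae_hasSum_fibre_iff g a hT b
  simp only [← div_eq_mul_inv] at h1
  rw [← h1]
  constructor
  · intro h
    have h2 := IsNormalizedTightFrame.ae_hasSum_fibre g a hT (by rwa [inv_inv])
    rwa [inv_inv] at h2
  · intro h
    have h2 := isNormalizedTightFrame_of_ae_hasSum_fibre g a hT (by rwa [inv_inv])
    rwa [inv_inv] at h2

theorem ae_hasSum_autocorrelation_iff (g : L2R) (a b : ℝ) :
    (∀ k : ℤ, ∀ᵐ x : ℝ, HasSum (fun n : ℤ => g (x - n * a) * conj (g (x - n * a - k / b)))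
        (if k = 0 then (b : ℂ) else 0)) ↔
      (∀ᵐ x : ℝ, HasSum (fun n : ℤ => ‖g (x - n * a)‖ ^ 2) b) ∧
        ∀ k : ℤ, k ≠ 0 → ∀ᵐ x : ℝ,
          HasSum (fun n : ℤ => g (x - n * a) * conj (g (x - n * a - k / b))) 0 := by
  have h0 : (∀ᵐ x : ℝ, HasSum (fun n : ℤ => g (x - n * a) *
      conj (g (x - n * a - ((0 : ℤ) : ℝ) / b))) (if (0 : ℤ) = 0 then (b : ℂ) else 0)) ↔
        ∀ᵐ x : ℝ, HasSum (fun n : ℤ => ‖g (x - n * a)‖ ^ 2) b := by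
    simp only [Int.cast_zero, zero_div, sub_zero, if_true, hasSum_norm_sq_iff]
  rw [← h0]
  constructor
  · exact fun h => ⟨h 0, fun k hk => by simpa only [if_neg hk] using h k⟩
  · rintro ⟨h1, h2⟩ k
    by_cases hk : k = 0
    · subst hk
      exact h1
    · simpa only [if_neg hk] using h2 k hk

/-- The dual system is the system with parameters `b⁻¹` and `a⁻¹`. -/
theorem pairwise_dual_iff (g : L2R) (a b : ℝ) :
    (Pairwise fun p q : ℤ × ℤ => inner ℂ (modulation (p.1 / a) (translation (p.2 / b) g))
        (modulation (q.1 / a) (translation (q.2 / b) g)) = 0) ↔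
      ∀ n m : ℤ, (n, m) ≠ (0, 0) →
        inner ℂ g (modulation (n / a) (translation (m / b) g)) = 0 := by
  simp only [div_eq_mul_inv]
  refine (pairwise_inner_system_eq_zero_iff g b⁻¹ a⁻¹).trans ⟨fun h n m => h (n, m), fun h p => ?_⟩
  exact h p.1 p.2

end WeylHeisenberg

theorem theorem2p2 (g : WeylHeisenberg.L2R) (a b : ℝ) (ha : 0 < a) (hb : 0 < b) :
    List.TFAE [
      WeylHeisenberg.IsNormalizedTightFrame (WeylHeisenberg.system g a b),
      (∀ᵐ x : ℝ, HasSum (fun n : ℤ => ‖g (x - n * a)‖ ^ 2) b) ∧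
        (∀ k : ℤ, k ≠ 0 → ∀ᵐ x : ℝ,
          HasSum (fun n : ℤ => g (x - n * a) * conj (g (x - n * a - k / b))) 0),
      (∀ n m : ℤ, (n, m) ≠ (0, 0) →
          inner ℂ g (WeylHeisenberg.modulation (n / a) (WeylHeisenberg.translation (m / b) g)) = 0) ∧
        ‖g‖ ^ 2 = a * b,
      (Pairwise fun p q : ℤ × ℤ =>
          inner ℂ (WeylHeisenberg.modulation (p.1 / a) (WeylHeisenberg.translation (p.2 / b) g))
            (WeylHeisenberg.modulation (q.1 / a) (WeylHeisenberg.translation (q.2 / b) g)) = 0) ∧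
        ‖g‖ ^ 2 = a * b,
      WeylHeisenberg.IsFrame (WeylHeisenberg.system g a b) ∧
        WeylHeisenberg.frameOperator (WeylHeisenberg.system g a b) g = g] ∧
    (WeylHeisenberg.IsNormalizedTightFrame (WeylHeisenberg.system g a b) →
      ((∃ e : HilbertBasis (ℤ × ℤ) ℂ WeylHeisenberg.L2R, ⇑e = WeylHeisenberg.system g a b) ↔
        ‖g‖ = 1)) := by
  refine ⟨?_, fun h => ?_⟩
  · tfae_have 1 ↔ 2 :=
      (WeylHeisenberg.isNormalizedTightFrame_system_iff_ae_hasSum g a hb).trans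
        (WeylHeisenberg.ae_hasSum_autocorrelation_iff g a b)
    tfae_have 3 ↔ 2 :=
      (WeylHeisenberg.inner_dual_eq_zero_iff_ae_hasSum g ha b).trans
        (WeylHeisenberg.ae_hasSum_autocorrelation_iff g a b)
    tfae_have 4 ↔ 3 := and_congr_left' (WeylHeisenberg.pairwise_dual_iff g a b)
    tfae_have 1 ↔ 5 := WeylHeisenberg.isNormalizedTightFrame_system_iff g a b
    tfae_finish
  · rw [h.exists_hilbertBasis_iff]
    simp only [WeylHeisenberg.norm_system, forall_const]
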